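/- Let $\mathcal D_1,\mathcal D_2$ be two dyadic grids in $\mathbb R$: each consists, for every $k\in\mathbb Z$, of a partition of $\mathbb R$ into half-open intervals $[a,a+2^k)$, and any two intervals of the grid are nested or disjoint. For $I\in\mathcal D_i$ with left and right halves $I_l,I_r$ let $h_I=|I|^{-1/2}(1_{I_l}-1_{I_r})$, and for a dyadic rectangle $R=I\times J\in\mathcal D:=\mathcal D_1\times\mathcal D_2$ let $h_R(x_1,x_2)=h_I(x_1)h_J(x_2)$. Let $(\epsilon_R)_{R\in\mathcal D}$ be real or complex scalars with $\sup_R|\epsilon_R|\le C_\epsilon<\infty$. Let $w$ be a bi-parameter $A_2$ weight, that is, a positive locally integrable function on $\mathbb R\times\mathbb R$ with $$[w]_{A_2}:=\sup_{R}\Big(\frac1{|R|}\int_R w\,dx\Big)\Big(\frac1{|R|}\int_R w^{-1}\,dx\Big)<\infty ,$$ where the supremum is over all bounded rectangles $R$ of positive area with sides parallel to the axes (not only the dyadic ones). Then for every $f\in L^2(w)=L^2(\mathbb R^2,w(x)\,dx)$ the integrals $\langle f,h_R\rangle=\int_{\mathbb R^2} f h_R\,dx$ converge absolutely, the series $$Tf=\sum_{R\in\mathcal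 D}\epsilon_R\,\langle f,h_R\rangle\,h_R$$ (the bi-parameter martingale transform of $f$) converges unconditionally in $L^2(w)$, and $$\|Tf\|_{L^2(w)}\le C\,C_\epsilon\,[w]_{A_2}^{8}\,\|f\|_{L^2(w)},$$ where $C$ is an absolute constant, independent of $\mathcal D_1,\mathcal D_2$, $(\epsilon_R)$, $C_\epsilon$, $w$ and $f$. -/

import Mathlib

open MeasureTheory Set Filter Topology
open scoped ENNReal NNReal

noncomputable section

/-- A dyadic grid (dyadic lattice) in `ℝ`: for every `k : ℤ` the line is partitioned into the
intervals `[offset k + n 2^k, offset k + (n + 1) 2^k)`, `n : ℤ`, and the partition of generation `k`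
refines the partition of generation `k + 1`. The standard grid has `offset = 0`. Every collection
of half-open intervals which consists, for each `k`, of a partition of `ℝ` into intervals of
length `2^k`, any two members of the collection being nested or disjoint, is of this form. -/
structure DyadicGrid where
  offset : ℤ → ℝ
  nested : ∀ k : ℤ, ∃ m : ℤ, offset (k + 1) = offset k + (m : ℝ) * (2 : ℝ) ^ k

/-- Labels of the intervals of a dyadic grid: `(k, n)` is the `n`-th interval of length `2^k`. -/
abbrev DyadicIndex : Type := ℤ × ℤ

/-- Labels of the dyadic rectangles of a product of two dyadic grids. -/
abbrev RectIndex : Type := DyadicIndex × DyadicIndex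

namespace DyadicGrid

/-- The length `|I| = 2^k` of a dyadic interval. -/
def length (I : DyadicIndex) : ℝ := (2 : ℝ) ^ I.1

/-- The left endpoint of a dyadic interval. -/
def left (D : DyadicGrid) (I : DyadicIndex) : ℝ := D.offset I.1 + (I.2 : ℝ) * length I

/-- The left child of a dyadic interval. -/
def leftChild (D : DyadicGrid) (I : DyadicIndex) : Set ℝ :=
  Ico (D.left I) (D.left I + length I / 2)

/-- The right child of a dyadic interval. -/
def rightChild (D : DyadicGrid) (I : DyadicIndex) : Set ℝ :=
  Ico (D.left I + length I / 2) (D.left I + length I)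

/-- The Haar function `h_I = |I|^{-1/2} (1_{I_l} - 1_{I_r})`. -/
def haar (D : DyadicGrid) (I : DyadicIndex) (t : ℝ) : ℝ :=
  (Real.sqrt (length I))⁻¹ *
    ((D.leftChild I).indicator (fun _ => (1 : ℝ)) t -
      (D.rightChild I).indicator (fun _ => (1 : ℝ)) t)

end DyadicGrid

/-- The bi-parameter Haar function `h_R(x₁, x₂) = h_I(x₁) h_J(x₂)` of `R = I × J`. -/
def biHaar (D₁ D₂ : DyadicGrid) (R : RectIndex) (x : ℝ × ℝ) : ℝ :=
  D₁.haar R.1 x.1 * D₂.haar R.2 x.2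

/-- The Haar coefficient `⟨f, h_R⟩ = ∫ f h_R` (with respect to Lebesgue measure on `ℝ²`). -/
def haarCoeff {𝕜 : Type*} [RCLike 𝕜] (D₁ D₂ : DyadicGrid) (f : ℝ × ℝ → 𝕜) (R : RectIndex) : 𝕜 :=
  ∫ x, f x * (biHaar D₁ D₂ R x : 𝕜)

/-- The bi-parameter `A₂` characteristic: the supremum over all rectangles with sides parallel to
the axes of the average of `w` times the average of `w⁻¹`. -/
def biA2Char (w : ℝ × ℝ → ℝ) : ℝ≥0∞ :=
  ⨆ (a : ℝ) (b : ℝ) (c : ℝ) (d : ℝ) (_ : a < b) (_ : c < d),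
    (⨍⁻ x in Icc a b ×ˢ Icc c d, ENNReal.ofReal (w x) ∂(volume : Measure (ℝ × ℝ))) *
      (⨍⁻ x in Icc a b ×ˢ Icc c d, ENNReal.ofReal ((w x)⁻¹) ∂(volume : Measure (ℝ × ℝ)))

/-- Bi-parameter `A₂(ℝ × ℝ)` weights. -/
structure IsBiA2Weight (w : ℝ × ℝ → ℝ) : Prop where
  locallyIntegrable : LocallyIntegrable w
  pos : ∀ᵐ x, 0 < w x
  char_lt_top : biA2Char w < ∞

/-- The measure `w(x) dx` on `ℝ²`. -/
def weightMeasure (w : ℝ × ℝ → ℝ) : Measure (ℝ × ℝ) :=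
  (volume : Measure (ℝ × ℝ)).withDensity fun x => ENNReal.ofReal (w x)

/-- `g` is the bi-parameter martingale transform `Tf = ∑_R ε_R ⟨f, h_R⟩ h_R`, the series converging
unconditionally to `g` in `L²(w)`: all Haar coefficients of `f` are defined by convergent integrals,
`g ∈ L²(w)`, and the finite partial sums tend to `g` in `L²(w)` along the directed set of finite
sets of dyadic rectangles. -/
structure IsMartingaleTransform {𝕜 : Type*} [RCLike 𝕜] (D₁ D₂ : DyadicGrid) (ε : RectIndex → 𝕜)
    (w : ℝ × ℝ → ℝ) (f g : ℝ × ℝ → 𝕜) : Prop where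
  integrable : ∀ R : RectIndex, Integrable fun x => f x * (biHaar D₁ D₂ R x : 𝕜)
  memLp : MemLp g 2 (weightMeasure w)
  tendsto : Tendsto
    (fun F : Finset RectIndex =>
      eLpNorm (fun x => g x - ∑ R ∈ F, ε R * haarCoeff D₁ D₂ f R * (biHaar D₁ D₂ R x : 𝕜)) 2
        (weightMeasure w))
    atTop (𝓝 0)

end

/-!
The proof compares norms in `L²(w)` with the bi-parameter dyadic square function. Write `σ = w⁻¹`,
`A = [w]_{A₂}`, and `⟨·⟩_R` for averages over dyadic rectangles.

In one variable, `∑ |⟨f, h_I⟩|² / ⟨σ⟩_I ≤ 50 A² ∫ f² w`. This follows from a Bellman function of the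
averages `x = ⟨f⟩`, `s = ⟨σ⟩`, `v = ⟨w⟩`, namely `2 x² / s + 48 A² x² / m` with
`m = 2 s - s² v / (3 A²) - 2 / (3 v)`, which gains one term of the sum in each bisection
(`bellman_step`). Only the averages enter, so the inequality can be iterated over the sides of
rectangles without passing to the restrictions of `w` to lines: the averages of `w` over `I × J`
with `J` fixed satisfy the same `A₂` condition in `I`. This gives
`∑ |⟨f, h_R⟩|² / ⟨σ⟩_R ≤ 2500 A⁴ ∫ |f|² w` (`IsDyadicA2Pair.sum_haarCoeff_sq`).

Applied to the weight `σ`, the same inequality yields by duality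
`‖∑ c_R h_R‖² ≤ 2500 A⁴ ∑ |c_R|² ⟨w⟩_R` in `L²(w)` for finite sums
(`IsDyadicA2Pair.integral_norm_sq_sum_le`). As `⟨w⟩_R ≤ A / ⟨σ⟩_R`, the coefficients
`c_R = ε_R ⟨f, h_R⟩` make the right side summable, with sum at most
`(2500 Cε)² A⁹ ∫ |f|² w`. Completeness of `L²(w)` gives unconditional convergence.
-/

/-! ### The one-step inequality for averages over an interval and its halves -/

/-- Strict convexity of `a² / p` with the main term of the defect: with half-differences
`y = (a - b) / 2`, `δ = (p - q) / 2` and averages `x`, `s`, the defect at the midpoint is at least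
`(y - x δ / s)² / s`. -/
theorem sq_div_sub_le {a b p q : ℝ} (hp : 0 < p) (hq : 0 < q) :
    ((a - b) / 2 - (a + b) / 2 * ((p - q) / 2) / ((p + q) / 2)) ^ 2 / ((p + q) / 2) ≤
      (a ^ 2 / p + b ^ 2 / q) / 2 - ((a + b) / 2) ^ 2 / ((p + q) / 2) := by
  have h1 : (a ^ 2 / p + b ^ 2 / q) / 2 - ((a + b) / 2) ^ 2 / ((p + q) / 2) -
      ((a - b) / 2 - (a + b) / 2 * ((p - q) / 2) / ((p + q) / 2)) ^ 2 / ((p + q) / 2) =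
      (a * q - b * p) ^ 2 * (p - q) ^ 2 / (2 * p * q * (p + q) ^ 3) := by
    field_simp
    ring
  have : 0 ≤ (a * q - b * p) ^ 2 * (p - q) ^ 2 / (2 * p * q * (p + q) ^ 3) := by positivity
  linarith

theorem sq_div_convex {a b p q : ℝ} (hp : 0 < p) (hq : 0 < q) :
    ((a + b) / 2) ^ 2 / ((p + q) / 2) ≤ (a ^ 2 / p + b ^ 2 / q) / 2 := by
  have h := sq_div_sub_le (a := a) (b := b) hp hq
  have : 0 ≤ ((a - b) / 2 - (a + b) / 2 * ((p - q) / 2) / ((p + q) / 2)) ^ 2 / ((p + q) / 2) := by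
    positivity
  linarith

/-- The average `s` of `σ` with a correction that depends on the average `v` of `σ⁻¹`. It stays
between `s` and `2s` while, under the `A₂` condition, its defect at a midpoint dominates the square
of the difference of the two values of `s`. It plays the role of `s` plus a Carleson mass. -/
noncomputable def correctedAverage (A s v : ℝ) : ℝ := 2 * s - s ^ 2 * v / (3 * A ^ 2) - 2 / (3 * v)

theorem correctedAverage_le {A s v : ℝ} (hs : 0 < s) (hv : 0 < v) :
    correctedAverage A s v ≤ 2 * s := by
  have h1 : 0 ≤ s ^ 2 * v / (3 * A ^ 2) := by positivity
  have h2 : 0 ≤ 2 / (3 * v) := by positivity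
  unfold correctedAverage
  linarith

theorem le_correctedAverage {A s v : ℝ} (hs : 0 < s) (hv : 0 < v) (h1 : 1 ≤ s * v)
    (hA : s * v ≤ A) : s ≤ correctedAverage A s v := by
  have hA1 : 1 ≤ A := h1.trans hA
  have h2 : s ^ 2 * v / (3 * A ^ 2) ≤ s / 3 := by
    rw [div_le_div_iff₀ (by positivity) (by norm_num)]
    have : s * v ≤ A ^ 2 := by nlinarith
    nlinarith
  have h3 : 2 / (3 * v) ≤ 2 * s / 3 := by
    rw [div_le_div_iff₀ (by positivity) (by norm_num)]
    nlinarith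
  unfold correctedAverage
  linarith

/-- The defect of `1 / v` controls the oscillation `η` of `v`, and `s² v` is convex in `s` up to a
multiple of `η²`. The combination `2 s² v + 4 A² / v` therefore gains `δ² / s`, where `δ` is the
oscillation of `s`. -/
theorem correctedAverage_concave {A s₁ s₂ v₁ v₂ : ℝ} (hs₁ : 0 < s₁) (hs₂ : 0 < s₂)
    (hv₁ : 0 < v₁) (hv₂ : 0 < v₂) (h1 : 1 ≤ (s₁ + s₂) / 2 * ((v₁ + v₂) / 2))
    (hA : (s₁ + s₂) / 2 * ((v₁ + v₂) / 2) ≤ A) :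
    ((s₁ - s₂) / 2) ^ 2 / ((s₁ + s₂) / 2) / (6 * A ^ 2) ≤
      correctedAverage A ((s₁ + s₂) / 2) ((v₁ + v₂) / 2) -
        (correctedAverage A s₁ v₁ + correctedAverage A s₂ v₂) / 2 := by
  obtain ⟨s, hs⟩ : ∃ s, s = (s₁ + s₂) / 2 := ⟨_, rfl⟩
  obtain ⟨δ, hδ⟩ : ∃ δ, δ = (s₁ - s₂) / 2 := ⟨_, rfl⟩
  obtain ⟨v, hv⟩ : ∃ v, v = (v₁ + v₂) / 2 := ⟨_, rfl⟩
  obtain ⟨η, hη⟩ : ∃ η, η = (v₁ - v₂) / 2 := ⟨_, rfl⟩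
  have hs0 : 0 < s := by linarith
  have hv0 : 0 < v := by linarith
  have hA1 : 1 ≤ A := h1.trans hA
  have es₁ : s₁ = s + δ := by linarith
  have es₂ : s₂ = s - δ := by linarith
  have ev₁ : v₁ = v + η := by linarith
  have ev₂ : v₂ = v - η := by linarith
  rw [← hs, ← hv] at h1 hA ⊢
  rw [← hδ]
  have hinv : η ^ 2 / v ^ 3 ≤ (1 / v₁ + 1 / v₂) / 2 - 1 / v := by
    have e : (1 / v₁ + 1 / v₂) / 2 - 1 / v = η ^ 2 / (v * (v₁ * v₂)) := by
      have := hv₁.ne'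
      have := hv₂.ne'
      rw [hη]
      subst hv
      field_simp
      ring
    rw [e]
    apply div_le_div_of_nonneg_left (by positivity) (by positivity)
    have : v₁ * v₂ ≤ v ^ 2 := by rw [ev₁, ev₂]; nlinarith [sq_nonneg η]
    nlinarith
  have hpoly : (s₁ ^ 2 * v₁ + s₂ ^ 2 * v₂) / 2 - s ^ 2 * v = v * δ ^ 2 + 2 * s * δ * η := by
    rw [es₁, es₂, ev₁, ev₂]; ring
  have hyoung : v * δ ^ 2 ≤ 2 * (v * δ ^ 2 + 2 * s * δ * η) + 4 * s ^ 2 * η ^ 2 / v := by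
    have : 2 * (v * δ ^ 2 + 2 * s * δ * η) + 4 * s ^ 2 * η ^ 2 / v - v * δ ^ 2 =
      (v * δ + 2 * s * η) ^ 2 / v := by field_simp; ring
    have : 0 ≤ (v * δ + 2 * s * η) ^ 2 / v := by positivity
    linarith
  have hcross : 4 * s ^ 2 * η ^ 2 / v ≤ 4 * A ^ 2 * (η ^ 2 / v ^ 3) := by
    have e : 4 * s ^ 2 * η ^ 2 / v = 4 * (s * v) ^ 2 * (η ^ 2 / v ^ 3) := by field_simp
    rw [e]
    gcongr
  have hlow : δ ^ 2 / s ≤ v * δ ^ 2 := by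
    rw [div_le_iff₀ hs0]
    nlinarith [sq_nonneg δ]
  -- The gain of `2 s² v` is at least `v δ²` up to an error in `η`, which `4 A² / v` absorbs.
  have key : δ ^ 2 / s ≤ 2 * ((s₁ ^ 2 * v₁ + s₂ ^ 2 * v₂) / 2 - s ^ 2 * v) +
      4 * A ^ 2 * ((1 / v₁ + 1 / v₂) / 2 - 1 / v) := by
    have : 4 * A ^ 2 * (η ^ 2 / v ^ 3) ≤ 4 * A ^ 2 * ((1 / v₁ + 1 / v₂) / 2 - 1 / v) := by gcongr
    linarith
  rw [div_le_iff₀ (by positivity)]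
  refine key.trans (le_of_eq ?_)
  unfold correctedAverage
  rw [es₁, es₂]
  have := hv₁.ne'
  have := hv₂.ne'
  field_simp
  ring

/-- The Bellman function of the weighted square function; `x`, `s`, `v` stand for the averages of
`f`, `σ` and `σ⁻¹`. Its first term controls the difference of the `σ`-averages of `f / σ`, its
second term is a Carleson embedding. -/
noncomputable def bellman (A x s v : ℝ) : ℝ :=
  2 * (x ^ 2 / s) + 48 * A ^ 2 * (x ^ 2 / correctedAverage A s v)

theorem bellman_nonneg {A x s v : ℝ} (hs : 0 < s) (hv : 0 < v) (h1 : 1 ≤ s * v)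
    (hA : s * v ≤ A) : 0 ≤ bellman A x s v := by
  have := hs.trans_le (le_correctedAverage hs hv h1 hA)
  unfold bellman
  positivity

theorem bellman_le {A x s v : ℝ} (hs : 0 < s) (hv : 0 < v) (h1 : 1 ≤ s * v)
    (hA : s * v ≤ A) : bellman A x s v ≤ 50 * A ^ 2 * (x ^ 2 / s) := by
  have hm := le_correctedAverage hs hv h1 hA
  have hA1 : 1 ≤ A ^ 2 := one_le_pow₀ (h1.trans hA)
  have h2 : x ^ 2 / correctedAverage A s v ≤ x ^ 2 / s :=
    div_le_div_of_nonneg_left (sq_nonneg x) hs hm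
  have h3 : 0 ≤ x ^ 2 / s := by positivity
  unfold bellman
  nlinarith

/-- Passing from an interval to its halves, the Bellman function gains the corresponding term of the
square function. -/
theorem bellman_step {A x₁ x₂ s₁ s₂ v₁ v₂ : ℝ} (hs₁ : 0 < s₁) (hs₂ : 0 < s₂)
    (hv₁ : 0 < v₁) (hv₂ : 0 < v₂) (h₁ : 1 ≤ s₁ * v₁) (h₂ : 1 ≤ s₂ * v₂)
    (hA₁ : s₁ * v₁ ≤ A) (hA₂ : s₂ * v₂ ≤ A) (h : 1 ≤ (s₁ + s₂) / 2 * ((v₁ + v₂) / 2))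
    (hA : (s₁ + s₂) / 2 * ((v₁ + v₂) / 2) ≤ A) :
    bellman A ((x₁ + x₂) / 2) ((s₁ + s₂) / 2) ((v₁ + v₂) / 2) +
        ((x₁ - x₂) / 2) ^ 2 / ((s₁ + s₂) / 2) ≤
      (bellman A x₁ s₁ v₁ + bellman A x₂ s₂ v₂) / 2 := by
  have hconc := correctedAverage_concave hs₁ hs₂ hv₁ hv₂ h hA
  have hm₁ := hs₁.trans_le (le_correctedAverage hs₁ hv₁ h₁ hA₁)
  have hm₂ := hs₂.trans_le (le_correctedAverage hs₂ hv₂ h₂ hA₂)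
  have hm₁' := correctedAverage_le (A := A) hs₁ hv₁
  have hm₂' := correctedAverage_le (A := A) hs₂ hv₂
  have hm := le_correctedAverage (by linarith) (by linarith) h hA
  have hm' := correctedAverage_le (A := A) (s := (s₁ + s₂) / 2) (v := (v₁ + v₂) / 2)
    (by linarith) (by linarith)
  have hc := sq_div_convex (a := x₁) (b := x₂) hm₁ hm₂
  have hd := sq_div_sub_le (a := x₁) (b := x₂) hs₁ hs₂
  have hA1 : 1 ≤ A := h.trans hA
  unfold bellman
  generalize correctedAverage A s₁ v₁ = m₁ at *
  generalize correctedAverage A s₂ v₂ = m₂ at *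
  generalize correctedAverage A ((s₁ + s₂) / 2) ((v₁ + v₂) / 2) = m at *
  have hs0 : 0 < (s₁ + s₂) / 2 := by linarith
  have hM0 : 0 < (m₁ + m₂) / 2 := by linarith
  have hM2 : (m₁ + m₂) / 2 ≤ 2 * ((s₁ + s₂) / 2) := by linarith
  generalize (s₁ + s₂) / 2 = s at *
  generalize (m₁ + m₂) / 2 = M at *
  generalize (s₁ - s₂) / 2 = δ at *
  obtain ⟨x, hx⟩ : ∃ x, x = (x₁ + x₂) / 2 := ⟨_, rfl⟩
  obtain ⟨y, hy⟩ : ∃ y, y = (x₁ - x₂) / 2 := ⟨_, rfl⟩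
  rw [← hx] at hc
  rw [← hx, ← hy] at hd ⊢
  have hm0 : 0 < m := hs0.trans_le hm
  -- The concavity of the corrected average turns into a gain for the second Bellman term.
  have hMm : x ^ 2 * (δ ^ 2 / s / (6 * A ^ 2)) / (2 * s * (2 * s)) ≤ x ^ 2 / M - x ^ 2 / m := by
    have e : x ^ 2 / M - x ^ 2 / m = x ^ 2 * (m - M) / (m * M) := by field_simp
    rw [e]
    have h0 : 0 ≤ δ ^ 2 / s / (6 * A ^ 2) := by positivity
    have h1 : m * M ≤ 2 * s * (2 * s) := by gcongr
    have h2 : 0 ≤ m - M := h0.trans hconc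
    gcongr
  have e1 : 48 * A ^ 2 * (x ^ 2 * (δ ^ 2 / s / (6 * A ^ 2)) / (2 * s * (2 * s))) =
      2 * ((x * δ / s) ^ 2 / s) := by field_simp; ring
  have h3 : 2 * ((x * δ / s) ^ 2 / s) ≤
      48 * A ^ 2 * ((x₁ ^ 2 / m₁ + x₂ ^ 2 / m₂) / 2 - x ^ 2 / m) := by
    rw [← e1]
    gcongr
    linarith
  have h4 : y ^ 2 / s ≤ 2 * ((y - x * δ / s) ^ 2 / s) + 2 * ((x * δ / s) ^ 2 / s) := by
    rw [← mul_div_assoc, ← mul_div_assoc, ← add_div]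
    gcongr
    nlinarith [sq_nonneg (y - 2 * (x * δ / s))]
  linarith

/-! ### Dyadic martingales -/

namespace DyadicGrid

theorem length_pos (I : DyadicIndex) : 0 < length I := zpow_pos (by norm_num) _

/-- The integer `m` with `offset (k + 1) = offset k + m 2^k`. -/
noncomputable def shift (D : DyadicGrid) (k : ℤ) : ℤ := (D.nested k).choose

theorem offset_succ (D : DyadicGrid) (k : ℤ) :
    D.offset (k + 1) = D.offset k + (D.shift k : ℝ) * (2 : ℝ) ^ k := (D.nested k).choose_spec

/-- The label, one generation down, of the left half of `I`. -/
noncomputable def lower (D : DyadicGrid) (I : DyadicIndex) : DyadicIndex :=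
  (I.1 - 1, D.shift (I.1 - 1) + 2 * I.2)

/-- The label, one generation down, of the right half of `I`. -/
noncomputable def upper (D : DyadicGrid) (I : DyadicIndex) : DyadicIndex :=
  (I.1 - 1, D.shift (I.1 - 1) + 2 * I.2 + 1)

@[simp] theorem length_lower (D : DyadicGrid) (I : DyadicIndex) :
    length (D.lower I) = length I / 2 := by
  simp [length, lower, zpow_sub_one₀, div_eq_mul_inv]

@[simp] theorem length_upper (D : DyadicGrid) (I : DyadicIndex) :
    length (D.upper I) = length I / 2 := by
  simp [length, upper, zpow_sub_one₀, div_eq_mul_inv]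

theorem left_lower (D : DyadicGrid) (I : DyadicIndex) : D.left (D.lower I) = D.left I := by
  have h := D.offset_succ (I.1 - 1)
  rw [sub_add_cancel] at h
  simp only [left, length_lower]
  rw [h]
  simp only [lower, length, zpow_sub_one₀ (two_ne_zero' ℝ)]
  push_cast
  ring

theorem left_upper (D : DyadicGrid) (I : DyadicIndex) :
    D.left (D.upper I) = D.left I + length I / 2 := by
  rw [← D.left_lower I]
  simp only [left, length_lower, length_upper]
  simp only [lower, upper]
  push_cast
  ring

/-- The intervals of length `2^k` are the halves of those of length `2^(k+1)`. -/
theorem tsum_generation (D : DyadicGrid) (Φ : DyadicIndex → ℝ≥0∞) (k : ℤ) :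
    ∑' n : ℤ, Φ (k, n) = ∑' n : ℤ, (Φ (D.lower (k + 1, n)) + Φ (D.upper (k + 1, n))) := by
  have e1 : ∀ n : ℤ, D.lower (k + 1, n) = (k, D.shift k + 2 * n) := by
    intro n; simp [lower]
  have e2 : ∀ n : ℤ, D.upper (k + 1, n) = (k, D.shift k + 2 * n + 1) := by
    intro n; simp [upper]
  simp only [e1, e2]
  let e : ℤ × Fin 2 ≃ ℤ :=
    { toFun := fun p => D.shift k + 2 * p.1 + (p.2 : ℕ)
      invFun := fun n => ((n - D.shift k) / 2, if (n - D.shift k) % 2 = 0 then 0 else 1)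
      left_inv := by
        rintro ⟨a, b⟩
        fin_cases b
        · simp
        · simp
          omega
      right_inv := by
        intro n
        by_cases h : (n - D.shift k) % 2 = 0 <;> simp [h] <;> omega }
  rw [← e.tsum_eq, ENNReal.tsum_prod']
  simp [e, tsum_fintype, add_assoc]

/-- Summing a gain inequality over all intervals longer than `2^k₀`. The intervals need not have a
common ancestor, so the sum runs over whole generations. -/
theorem tsum_telescope (D : DyadicGrid) {Φ T : DyadicIndex → ℝ≥0∞}
    (h : ∀ I, Φ I + T I ≤ Φ (D.lower I) + Φ (D.upper I)) (k₀ : ℤ) :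
    ∑' I : DyadicIndex, (if k₀ < I.1 then T I else 0) ≤ ∑' n : ℤ, Φ (k₀, n) := by
  have hstep : ∀ N : ℕ, ∑' n : ℤ, Φ (k₀ + N, n) +
      ∑ j ∈ Finset.range N, ∑' n : ℤ, T (k₀ + j + 1, n) ≤ ∑' n : ℤ, Φ (k₀, n) := by
    intro N
    induction N with
    | zero => simp
    | succ N ih =>
      refine le_trans ?_ ih
      rw [Finset.sum_range_succ, add_comm (∑ j ∈ _, _), ← add_assoc]
      gcongr
      rw [D.tsum_generation Φ (k₀ + N), ← ENNReal.tsum_add]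
      refine ENNReal.tsum_le_tsum fun n => ?_
      have := h (k₀ + N + 1, n)
      push_cast
      rwa [← add_assoc]
  have hinj : Function.Injective fun j : ℕ => k₀ + (j : ℤ) + 1 := by
    intro a b hab
    simpa using hab
  have : ∑' I : DyadicIndex, (if k₀ < I.1 then T I else 0) =
      ∑' j : ℕ, ∑' n : ℤ, T (k₀ + j + 1, n) := by
    rw [ENNReal.tsum_prod', ← hinj.tsum_eq]
    · refine tsum_congr fun j => tsum_congr fun n => ?_
      simp only
      rw [if_pos (by omega)]
    · intro k hk
      by_cases hlt : k₀ < k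
      · exact ⟨(k - k₀ - 1).toNat, by simp only; omega⟩
      · simp [hlt] at hk
  rw [this, ENNReal.tsum_eq_iSup_nat]
  exact iSup_le fun N => le_add_self.trans (hstep N)

/-- `x I` is the mean of the values of `x` on the two halves of `I`. -/
def IsMartingale (D : DyadicGrid) (x : DyadicIndex → ℝ) : Prop :=
  ∀ I, x I = (x (D.lower I) + x (D.upper I)) / 2

/-- Half the difference of the values on the two halves of `I`, the left one first. Up to the factor
`√|I|` this is the Haar coefficient, when `x` consists of averages. -/
noncomputable def halfDiff (D : DyadicGrid) (x : DyadicIndex → ℝ) (I : DyadicIndex) : ℝ :=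
  (x (D.lower I) - x (D.upper I)) / 2

/-- The one-parameter weighted square function estimate, in terms of averages `x`, `s`, `v` of `f`,
`σ`, `σ⁻¹` over intervals not shorter than `2^k₀`. -/
theorem tsum_halfDiff_le (D : DyadicGrid) {A : ℝ} {x s v : DyadicIndex → ℝ}
    (hx : D.IsMartingale x) (hs : D.IsMartingale s) (hv : D.IsMartingale v)
    (hs0 : ∀ I, 0 < s I) (hv0 : ∀ I, 0 < v I) (h1 : ∀ I, 1 ≤ s I * v I)
    (hA : ∀ I, s I * v I ≤ A) (k₀ : ℤ) :
    ∑' I : DyadicIndex,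
        (if k₀ < I.1 then ENNReal.ofReal (length I * (D.halfDiff x I ^ 2 / s I)) else 0) ≤
      ENNReal.ofReal (50 * A ^ 2) *
        ∑' n : ℤ, ENNReal.ofReal (length (k₀, n) * (x (k₀, n) ^ 2 / s (k₀, n))) := by
  have hb := fun I => bellman_nonneg (x := x I) (hs0 I) (hv0 I) (h1 I) (hA I)
  refine (D.tsum_telescope
    (Φ := fun I => ENNReal.ofReal (length I * bellman A (x I) (s I) (v I))) ?_ k₀).trans ?_
  · intro I
    have hl := length_pos I
    rw [← ENNReal.ofReal_add (mul_nonneg hl.le (hb I))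
        (mul_nonneg hl.le (div_nonneg (sq_nonneg _) (hs0 I).le)),
      ← ENNReal.ofReal_add (mul_nonneg (length_pos _).le (hb _))
        (mul_nonneg (length_pos _).le (hb _))]
    apply ENNReal.ofReal_le_ofReal
    have h := bellman_step (x₁ := x (D.lower I)) (x₂ := x (D.upper I)) (hs0 (D.lower I))
      (hs0 (D.upper I)) (hv0 _) (hv0 _) (h1 _) (h1 _) (hA _) (hA _)
      (by rw [← hs I, ← hv I]; exact h1 I) (by rw [← hs I, ← hv I]; exact hA I)
    rw [← hs I, ← hv I, ← hx I] at h
    rw [length_lower, length_upper]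
    unfold halfDiff
    nlinarith
  · rw [← ENNReal.tsum_mul_left]
    refine ENNReal.tsum_le_tsum fun n => ?_
    have hA1 := (h1 (k₀, n)).trans (hA _)
    rw [← ENNReal.ofReal_mul (by positivity)]
    apply ENNReal.ofReal_le_ofReal
    have := bellman_le (x := x (k₀, n)) (hs0 _) (hv0 _) (h1 (k₀, n)) (hA _)
    have hl := length_pos (k₀, n)
    nlinarith

end DyadicGrid

open DyadicGrid

/-- The iterated half-difference in both variables over the four quarters of `R`. -/
noncomputable def biHalfDiff (D₁ D₂ : DyadicGrid) (x : RectIndex → ℝ) (R : RectIndex) : ℝ :=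
  D₂.halfDiff (fun J => D₁.halfDiff (fun I => x (I, J)) R.1) R.2

/-- Martingale in each of the two variables separately, as the averages over rectangles are. -/
def IsBiMartingale (D₁ D₂ : DyadicGrid) (x : RectIndex → ℝ) : Prop :=
  (∀ J, D₁.IsMartingale fun I => x (I, J)) ∧ ∀ I, D₂.IsMartingale fun J => x (I, J)

/-- The bi-parameter square function estimate. The one-parameter estimate is applied in the second
variable to the differences in the first variable over a fixed `I`, down to intervals of length
`2^l₀`; each of these is then fixed for the estimate in the first variable. The averages of the
weight over `I × J`, with one side fixed, satisfy the `A₂` condition in the other side. -/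
theorem tsum_biHalfDiff_le (D₁ D₂ : DyadicGrid) {A : ℝ} {x s v : RectIndex → ℝ}
    (hx : IsBiMartingale D₁ D₂ x) (hs : IsBiMartingale D₁ D₂ s) (hv : IsBiMartingale D₁ D₂ v)
    (hs0 : ∀ R, 0 < s R) (hv0 : ∀ R, 0 < v R) (h1 : ∀ R, 1 ≤ s R * v R)
    (hA : ∀ R, s R * v R ≤ A) (k₀ l₀ : ℤ) :
    ∑' R : RectIndex, (if k₀ < R.1.1 ∧ l₀ < R.2.1 then
        ENNReal.ofReal (length R.1 * length R.2 * (biHalfDiff D₁ D₂ x R ^ 2 / s R)) else 0) ≤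
      ENNReal.ofReal (50 * A ^ 2) ^ 2 * ∑' p : ℤ × ℤ,
        ENNReal.ofReal (length (k₀, p.1) * length (l₀, p.2) *
          (x ((k₀, p.1), (l₀, p.2)) ^ 2 / s ((k₀, p.1), (l₀, p.2)))) := by
  have hmart : ∀ I, D₂.IsMartingale fun J => D₁.halfDiff (fun I => x (I, J)) I := by
    intro I J
    have h1 := hx.2 (D₁.lower I) J
    have h2 := hx.2 (D₁.upper I) J
    simp only [halfDiff] at h1 h2 ⊢
    rw [h1, h2]
    ring
  have hofReal : ∀ (I : DyadicIndex) (r : ℝ), ENNReal.ofReal (length I * r) =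
      ENNReal.ofReal (length I) * ENNReal.ofReal r := fun I r =>
    ENNReal.ofReal_mul (length_pos I).le
  calc
    _ = ∑' I : DyadicIndex, if k₀ < I.1 then ENNReal.ofReal (length I) *
          ∑' J : DyadicIndex, (if l₀ < J.1 then ENNReal.ofReal (length J *
            (D₂.halfDiff (fun J => D₁.halfDiff (fun I => x (I, J)) I) J ^ 2 / s (I, J)))
            else 0) else 0 := by
      rw [ENNReal.tsum_prod']
      refine tsum_congr fun I => ?_
      split_ifs with hI
      · rw [← ENNReal.tsum_mul_left]
        refine tsum_congr fun J => ?_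
        by_cases hJ : l₀ < J.1
        · simp only [hI, hJ, and_self, if_true, mul_assoc, hofReal, biHalfDiff]
        · simp [hJ]
      · simp [hI]
    _ ≤ ∑' I : DyadicIndex, if k₀ < I.1 then ENNReal.ofReal (length I) *
          (ENNReal.ofReal (50 * A ^ 2) * ∑' n : ℤ, ENNReal.ofReal (length (l₀, n) *
            (D₁.halfDiff (fun I => x (I, (l₀, n))) I ^ 2 / s (I, (l₀, n))))) else 0 := by
      refine ENNReal.tsum_le_tsum fun I => ?_
      split_ifs
      · gcongr
        exact D₂.tsum_halfDiff_le (hmart I) (hs.2 I) (hv.2 I) (fun _ => hs0 _) (fun _ => hv0 _)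
          (fun _ => h1 _) (fun _ => hA _) l₀
      · exact le_rfl
    _ = ENNReal.ofReal (50 * A ^ 2) * ∑' n : ℤ, ENNReal.ofReal (length (l₀, n)) *
          ∑' I : DyadicIndex, if k₀ < I.1 then ENNReal.ofReal (length I *
            (D₁.halfDiff (fun I => x (I, (l₀, n))) I ^ 2 / s (I, (l₀, n)))) else 0 := by
      simp_rw [← ENNReal.tsum_mul_left]
      rw [ENNReal.tsum_comm]
      refine tsum_congr fun I => ?_
      split_ifs
      · refine tsum_congr fun n => ?_
        simp only [hofReal]
        ring
      · simp
    _ ≤ ENNReal.ofReal (50 * A ^ 2) * ∑' n : ℤ, ENNReal.ofReal (length (l₀, n)) *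
          (ENNReal.ofReal (50 * A ^ 2) * ∑' m : ℤ, ENNReal.ofReal (length (k₀, m) *
            (x ((k₀, m), (l₀, n)) ^ 2 / s ((k₀, m), (l₀, n))))) := by
      gcongr with n
      exact D₁.tsum_halfDiff_le (hx.1 _) (hs.1 _) (hv.1 _) (fun _ => hs0 _) (fun _ => hv0 _)
          (fun _ => h1 _) (fun _ => hA _) k₀
    _ = _ := by
      rw [ENNReal.tsum_prod', ENNReal.tsum_comm, sq (ENNReal.ofReal _), mul_assoc]
      congr 1
      simp_rw [← ENNReal.tsum_mul_left]
      refine tsum_congr fun n => tsum_congr fun m => ?_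
      simp_rw [mul_assoc, hofReal]
      ring

/-! ### Averages over dyadic rectangles -/

namespace DyadicGrid

/-- The half-open interval with label `I`. -/
def interval (D : DyadicGrid) (I : DyadicIndex) : Set ℝ := Ico (D.left I) (D.left I + length I)

theorem measurableSet_interval (D : DyadicGrid) (I : DyadicIndex) :
    MeasurableSet (D.interval I) := measurableSet_Ico

theorem interval_lower (D : DyadicGrid) (I : DyadicIndex) :
    D.interval (D.lower I) = D.leftChild I := by
  simp [interval, leftChild, left_lower]

theorem interval_upper (D : DyadicGrid) (I : DyadicIndex) :
    D.interval (D.upper I) = D.rightChild I := by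
  simp [interval, rightChild, left_upper, add_assoc]

theorem interval_eq_union (D : DyadicGrid) (I : DyadicIndex) :
    D.interval I = D.interval (D.lower I) ∪ D.interval (D.upper I) := by
  have := length_pos I
  rw [interval_lower, interval_upper, leftChild, rightChild, interval,
    Ico_union_Ico_eq_Ico (by linarith) (by linarith)]

theorem disjoint_lower_upper (D : DyadicGrid) (I : DyadicIndex) :
    Disjoint (D.interval (D.lower I)) (D.interval (D.upper I)) := by
  rw [interval_lower, interval_upper]
  exact Ico_disjoint_Ico_same

theorem disjoint_generation (D : DyadicGrid) (k : ℤ) :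
    Pairwise (Function.onFun Disjoint fun n : ℤ => D.interval (k, n)) := by
  have h := pairwise_disjoint_Ico_add_zsmul (D.offset k) ((2 : ℝ) ^ k)
  convert h using 2
  funext n
  simp only [interval, left, length, zsmul_eq_mul]
  push_cast
  congr 1
  ring

end DyadicGrid

/-- The dyadic rectangle with label `R`. -/
def dyadicRect (D₁ D₂ : DyadicGrid) (R : RectIndex) : Set (ℝ × ℝ) :=
  D₁.interval R.1 ×ˢ D₂.interval R.2

theorem measurableSet_dyadicRect (D₁ D₂ : DyadicGrid) (R : RectIndex) :
    MeasurableSet (dyadicRect D₁ D₂ R) :=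
  (D₁.measurableSet_interval _).prod (D₂.measurableSet_interval _)

/-- The area of a dyadic rectangle. -/
noncomputable def rectArea (R : RectIndex) : ℝ := length R.1 * length R.2

theorem rectArea_pos (R : RectIndex) : 0 < rectArea R := mul_pos (length_pos _) (length_pos _)

/-- The Lebesgue average of `φ` over a dyadic rectangle. -/
noncomputable def rectAvg (D₁ D₂ : DyadicGrid) (φ : ℝ × ℝ → ℝ) (R : RectIndex) : ℝ :=
  (∫ x in dyadicRect D₁ D₂ R, φ x) / rectArea R

theorem isBiMartingale_rectAvg {D₁ D₂ : DyadicGrid} {φ : ℝ × ℝ → ℝ}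
    (h : ∀ R, IntegrableOn φ (dyadicRect D₁ D₂ R)) :
    IsBiMartingale D₁ D₂ (rectAvg D₁ D₂ φ) := by
  constructor
  · intro J I
    have e : dyadicRect D₁ D₂ (I, J) =
        dyadicRect D₁ D₂ (D₁.lower I, J) ∪ dyadicRect D₁ D₂ (D₁.upper I, J) := by
      simp only [dyadicRect]
      rw [D₁.interval_eq_union I, union_prod]
    have hd : Disjoint (dyadicRect D₁ D₂ (D₁.lower I, J)) (dyadicRect D₁ D₂ (D₁.upper I, J)) :=
      Disjoint.set_prod_left (D₁.disjoint_lower_upper I) _ _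
    simp only [rectAvg, rectArea, length_lower, length_upper]
    rw [e, setIntegral_union hd (measurableSet_dyadicRect _ _ _) (h _) (h _)]
    have := (length_pos I).ne'
    have := (length_pos J).ne'
    field_simp
  · intro I J
    have e : dyadicRect D₁ D₂ (I, J) =
        dyadicRect D₁ D₂ (I, D₂.lower J) ∪ dyadicRect D₁ D₂ (I, D₂.upper J) := by
      simp only [dyadicRect]
      rw [D₂.interval_eq_union J, prod_union]
    have hd : Disjoint (dyadicRect D₁ D₂ (I, D₂.lower J)) (dyadicRect D₁ D₂ (I, D₂.upper J)) :=
      Disjoint.set_prod_right (D₂.disjoint_lower_upper J) _ _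
    simp only [rectAvg, rectArea, length_lower, length_upper]
    rw [e, setIntegral_union hd (measurableSet_dyadicRect _ _ _) (h _) (h _)]
    have := (length_pos I).ne'
    have := (length_pos J).ne'
    field_simp

theorem biHaar_eq (D₁ D₂ : DyadicGrid) (R : RectIndex) (x : ℝ × ℝ) :
    biHaar D₁ D₂ R x = (√(length R.1))⁻¹ * (√(length R.2))⁻¹ *
      ((dyadicRect D₁ D₂ (D₁.lower R.1, D₂.lower R.2)).indicator 1 x -
        (dyadicRect D₁ D₂ (D₁.upper R.1, D₂.lower R.2)).indicator 1 x -
        (dyadicRect D₁ D₂ (D₁.lower R.1, D₂.upper R.2)).indicator 1 x +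
        (dyadicRect D₁ D₂ (D₁.upper R.1, D₂.upper R.2)).indicator 1 x) := by
  have h : ∀ (s t : Set ℝ), (s ×ˢ t).indicator (1 : ℝ × ℝ → ℝ) x =
      s.indicator (fun _ => (1 : ℝ)) x.1 * t.indicator (fun _ => (1 : ℝ)) x.2 := by
    intro s t
    by_cases h1 : x.1 ∈ s <;> by_cases h2 : x.2 ∈ t <;> simp [indicator, h1, h2]
  simp only [dyadicRect, h, interval_lower, interval_upper, biHaar, haar]
  ring

theorem measurable_biHaar (D₁ D₂ : DyadicGrid) (R : RectIndex) : Measurable (biHaar D₁ D₂ R) := by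
  have : biHaar D₁ D₂ R = _ := funext (biHaar_eq D₁ D₂ R)
  rw [this]
  have h := fun R => measurableSet_dyadicRect D₁ D₂ R
  have h' := fun R => (measurable_one (α := ℝ) (β := ℝ × ℝ)).indicator (h R)
  exact ((((h' _).sub (h' _)).sub (h' _)).add (h' _)).const_mul _

section HaarCoeff

variable {𝕜 : Type*} [RCLike 𝕜] {D₁ D₂ : DyadicGrid} {f : ℝ × ℝ → 𝕜}

theorem mul_biHaar_eq (R : RectIndex) (x : ℝ × ℝ) :
    f x * (biHaar D₁ D₂ R x : 𝕜) = (((√(length R.1))⁻¹ * (√(length R.2))⁻¹ : ℝ) : 𝕜) *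
      ((dyadicRect D₁ D₂ (D₁.lower R.1, D₂.lower R.2)).indicator f x -
        (dyadicRect D₁ D₂ (D₁.upper R.1, D₂.lower R.2)).indicator f x -
        (dyadicRect D₁ D₂ (D₁.lower R.1, D₂.upper R.2)).indicator f x +
        (dyadicRect D₁ D₂ (D₁.upper R.1, D₂.upper R.2)).indicator f x) := by
  have h : ∀ s : Set (ℝ × ℝ), s.indicator f x = f x * ((s.indicator 1 x : ℝ) : 𝕜) := by
    intro s
    by_cases hx : x ∈ s <;> simp [hx]
  simp only [h, biHaar_eq]
  push_cast
  ring

theorem integrable_mul_biHaar (h : ∀ R, IntegrableOn f (dyadicRect D₁ D₂ R)) (R : RectIndex) :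
    Integrable fun x => f x * (biHaar D₁ D₂ R x : 𝕜) := by
  have h' := fun R => (h R).integrable_indicator (measurableSet_dyadicRect D₁ D₂ R)
  simp only [mul_biHaar_eq]
  exact ((((h' _).sub (h' _)).sub (h' _)).add (h' _)).const_mul _

theorem haarCoeff_eq (h : ∀ R, IntegrableOn f (dyadicRect D₁ D₂ R)) (R : RectIndex) :
    haarCoeff D₁ D₂ f R = (((√(length R.1))⁻¹ * (√(length R.2))⁻¹ : ℝ) : 𝕜) *
      ((∫ x in dyadicRect D₁ D₂ (D₁.lower R.1, D₂.lower R.2), f x) -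
        (∫ x in dyadicRect D₁ D₂ (D₁.upper R.1, D₂.lower R.2), f x) -
        (∫ x in dyadicRect D₁ D₂ (D₁.lower R.1, D₂.upper R.2), f x) +
        (∫ x in dyadicRect D₁ D₂ (D₁.upper R.1, D₂.upper R.2), f x)) := by
  have h' := fun R => (h R).integrable_indicator (measurableSet_dyadicRect D₁ D₂ R)
  unfold haarCoeff
  simp only [mul_biHaar_eq]
  have key : ∀ {a b c d : ℝ × ℝ → 𝕜}, Integrable a → Integrable b → Integrable c →
      Integrable d → ∫ x, (a x - b x - c x + d x) =
        (∫ x, a x) - (∫ x, b x) - (∫ x, c x) + ∫ x, d x := by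
    intro a b c d ha hb hc hd
    have hab : Integrable fun x => a x - b x := ha.sub hb
    have habc : Integrable fun x => a x - b x - c x := hab.sub hc
    rw [integral_add habc hd, integral_sub hab hc, integral_sub ha hb]
  rw [integral_const_mul, key (h' _) (h' _) (h' _) (h' _)]
  simp only [integral_indicator (measurableSet_dyadicRect D₁ D₂ _)]

theorem haarCoeff_re (h : ∀ R, IntegrableOn f (dyadicRect D₁ D₂ R)) (R : RectIndex) :
    haarCoeff D₁ D₂ (fun x => RCLike.re (f x)) R = RCLike.re (haarCoeff D₁ D₂ f R) := by
  have := integral_re (integrable_mul_biHaar h R)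
  unfold haarCoeff
  rw [← this]
  simp [RCLike.mul_re]

theorem haarCoeff_im (h : ∀ R, IntegrableOn f (dyadicRect D₁ D₂ R)) (R : RectIndex) :
    haarCoeff D₁ D₂ (fun x => RCLike.im (f x)) R = RCLike.im (haarCoeff D₁ D₂ f R) := by
  have := integral_im (integrable_mul_biHaar h R)
  unfold haarCoeff
  rw [← this]
  simp [RCLike.mul_im]

end HaarCoeff

theorem haarCoeff_sq {D₁ D₂ : DyadicGrid} {f : ℝ × ℝ → ℝ}
    (h : ∀ R, IntegrableOn f (dyadicRect D₁ D₂ R)) (R : RectIndex) :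
    haarCoeff D₁ D₂ f R ^ 2 = rectArea R * biHalfDiff D₁ D₂ (rectAvg D₁ D₂ f) R ^ 2 := by
  rw [haarCoeff_eq h]
  have h1 := length_pos R.1
  have h2 := length_pos R.2
  simp only [RCLike.ofReal_real_eq_id, id, mul_pow, inv_pow, Real.sq_sqrt h1.le,
    Real.sq_sqrt h2.le, biHalfDiff, halfDiff, rectAvg, rectArea, length_lower, length_upper]
  field_simp
  ring

/-! ### Weights -/

/-- `w` and `σ = w⁻¹` satisfy the `A₂` condition with constant `A` on the rectangles of
`D₁ × D₂`. The weight and its inverse are kept as two functions so that the condition is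
symmetric. -/
structure IsDyadicA2Pair (D₁ D₂ : DyadicGrid) (w σ : ℝ × ℝ → ℝ) (A : ℝ) : Prop where
  aestronglyMeasurable : AEStronglyMeasurable w
  pos : ∀ᵐ x, 0 < w x
  inv : ∀ᵐ x, σ x = (w x)⁻¹
  integrableOn_left : ∀ R, IntegrableOn w (dyadicRect D₁ D₂ R)
  integrableOn_right : ∀ R, IntegrableOn σ (dyadicRect D₁ D₂ R)
  avg_mul_avg_le : ∀ R, rectAvg D₁ D₂ w R * rectAvg D₁ D₂ σ R ≤ A

theorem integrable_of_integrable_sq_mul {α 𝕜 : Type*} [RCLike 𝕜] [MeasurableSpace α]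
    {μ : Measure α} {f : α → 𝕜} {w σ : α → ℝ} (hf : AEStronglyMeasurable f μ)
    (hw : ∀ᵐ x ∂μ, 0 < w x) (hσ : ∀ᵐ x ∂μ, σ x = (w x)⁻¹)
    (hfw : Integrable (fun x => ‖f x‖ ^ 2 * w x) μ) (hσi : Integrable σ μ) : Integrable f μ := by
  refine (hfw.add hσi).mono' hf ?_
  filter_upwards [hw, hσ] with x hx hx'
  have : 0 ≤ (‖f x‖ * w x - 1 / 2) ^ 2 / w x := by positivity
  have e : (‖f x‖ * w x - 1 / 2) ^ 2 / w x = ‖f x‖ ^ 2 * w x - ‖f x‖ + (w x)⁻¹ / 4 := by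
    field_simp
    ring
  have : 0 < (w x)⁻¹ := by positivity
  simp only [Pi.add_apply, hx']
  linarith

/-- The Cauchy–Schwarz inequality for `f = (f √w) √σ`. -/
theorem sq_integral_le {α : Type*} [MeasurableSpace α] {μ : Measure α} {f w σ : α → ℝ}
    (hf : AEStronglyMeasurable f μ) (hw : ∀ᵐ x ∂μ, 0 < w x) (hσ : ∀ᵐ x ∂μ, σ x = (w x)⁻¹)
    (hfw : Integrable (fun x => f x ^ 2 * w x) μ) (hσi : Integrable σ μ) :
    (∫ x, f x ∂μ) ^ 2 ≤ (∫ x, f x ^ 2 * w x ∂μ) * ∫ x, σ x ∂μ := by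
  have hfi : Integrable f μ :=
    integrable_of_integrable_sq_mul hf hw hσ (by simpa using hfw) hσi
  have h := discrim_le_zero (a := ∫ x, f x ^ 2 * w x ∂μ) (b := -2 * ∫ x, f x ∂μ)
    (c := ∫ x, σ x ∂μ) fun t => by
      have e : (∫ x, f x ^ 2 * w x ∂μ) * (t * t) + -2 * (∫ x, f x ∂μ) * t + ∫ x, σ x ∂μ =
          ∫ x, (t * t) * (f x ^ 2 * w x) + (-2 * t) * f x + σ x ∂μ := by
        have hadd : Integrable (fun x => t * t * (f x ^ 2 * w x) + -2 * t * f x) μ :=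
          (hfw.const_mul _).add (hfi.const_mul _)
        rw [integral_add hadd hσi, integral_add (hfw.const_mul _) (hfi.const_mul _),
          integral_const_mul, integral_const_mul]
        ring
      rw [e]
      apply integral_nonneg_of_ae
      filter_upwards [hw, hσ] with x hx hx'
      have e : t * t * (f x ^ 2 * w x) + -2 * t * f x + σ x = (t * f x * w x - 1) ^ 2 / w x := by
        rw [hx']
        field_simp
        ring
      rw [e, Pi.zero_apply]
      positivity
  unfold discrim at h
  nlinarith

namespace IsDyadicA2Pair

variable {D₁ D₂ : DyadicGrid} {w σ : ℝ × ℝ → ℝ} {A : ℝ}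

theorem symm (h : IsDyadicA2Pair D₁ D₂ w σ A) : IsDyadicA2Pair D₁ D₂ σ w A where
  aestronglyMeasurable :=
    h.aestronglyMeasurable.inv₀.congr (h.inv.mono fun x hx => hx.symm)
  pos := by
    filter_upwards [h.pos, h.inv] with x hx hx'
    rw [hx']
    positivity
  inv := by
    filter_upwards [h.inv] with x hx'
    rw [hx', inv_inv]
  integrableOn_left := h.integrableOn_right
  integrableOn_right := h.integrableOn_left
  avg_mul_avg_le R := by
    rw [mul_comm]
    exact h.avg_mul_avg_le R

theorem rectAvg_pos (h : IsDyadicA2Pair D₁ D₂ w σ A) (R : RectIndex) : 0 < rectAvg D₁ D₂ w R := by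
  refine div_pos ?_ (rectArea_pos R)
  rw [setIntegral_pos_iff_support_of_nonneg_ae
    (ae_restrict_of_ae (h.pos.mono fun x hx => hx.le)) (h.integrableOn_left R)]
  have h1 : volume (dyadicRect D₁ D₂ R) ≤ volume (Function.support w ∩ dyadicRect D₁ D₂ R) := by
    apply measure_mono_ae
    filter_upwards [h.pos] with x hx hxR
    exact ⟨hx.ne', hxR⟩
  refine lt_of_lt_of_le ?_ h1
  have h3 := length_pos R.1
  have h4 := length_pos R.2
  rw [dyadicRect, Measure.volume_eq_prod, Measure.prod_prod]
  simp only [interval, Real.volume_Ico, add_sub_cancel_left]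
  exact ENNReal.mul_pos (by simpa using h3) (by simpa using h4)

theorem one_le_avg_mul_avg (h : IsDyadicA2Pair D₁ D₂ w σ A) (R : RectIndex) :
    1 ≤ rectAvg D₁ D₂ w R * rectAvg D₁ D₂ σ R := by
  have h1 := sq_integral_le (μ := volume.restrict (dyadicRect D₁ D₂ R)) (f := fun _ => (1 : ℝ))
    aestronglyMeasurable_const (ae_restrict_of_ae h.pos) (ae_restrict_of_ae h.inv)
    (by simpa using (h.integrableOn_left R).integrable) (h.integrableOn_right R)
  have h2 : ∫ x in dyadicRect D₁ D₂ R, (1 : ℝ) = rectArea R := by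
    simp only [integral_const, smul_eq_mul, mul_one, measureReal_restrict_apply_univ]
    rw [dyadicRect, Measure.volume_eq_prod, measureReal_prod_prod]
    simp [interval, rectArea, measureReal_def, (length_pos _).le]
  have h3 := rectArea_pos R
  rw [h2] at h1
  simp only [one_pow, one_mul] at h1
  unfold rectAvg
  rw [div_mul_div_comm, one_le_div (by positivity), ← sq]
  exact h1

/-- The bi-parameter square function estimate for real functions. -/
theorem sum_haarCoeff_sq_real (h : IsDyadicA2Pair D₁ D₂ w σ A) {f : ℝ × ℝ → ℝ}
    (hf : AEStronglyMeasurable f) (hfw : Integrable fun x => f x ^ 2 * w x)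
    (F : Finset RectIndex) :
    ∑ R ∈ F, haarCoeff D₁ D₂ f R ^ 2 / rectAvg D₁ D₂ σ R ≤
      2500 * A ^ 4 * ∫ x, f x ^ 2 * w x := by
  have hfi : ∀ R, IntegrableOn f (dyadicRect D₁ D₂ R) := fun R =>
    integrable_of_integrable_sq_mul hf.restrict (ae_restrict_of_ae h.pos)
      (ae_restrict_of_ae h.inv) (by simpa using hfw.integrableOn.integrable)
      (h.integrableOn_right R)
  have hnn : 0 ≤ᵐ[volume] fun x => f x ^ 2 * w x := by
    filter_upwards [h.pos] with x hx
    simp only [Pi.zero_apply]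
    positivity
  have hA1 := (h.one_le_avg_mul_avg ((0, 0), (0, 0))).trans (h.avg_mul_avg_le _)
  obtain ⟨k₀, hk₀⟩ : ∃ k₀ : ℤ, ∀ R ∈ F, k₀ < R.1.1 := by
    obtain ⟨b, hb⟩ := (F.image fun R => R.1.1).bddBelow
    exact ⟨b - 1, fun R hR => by
      have : b ≤ R.1.1 := hb (Finset.mem_coe.2 (Finset.mem_image_of_mem _ hR))
      omega⟩
  obtain ⟨l₀, hl₀⟩ : ∃ l₀ : ℤ, ∀ R ∈ F, l₀ < R.2.1 := by
    obtain ⟨b, hb⟩ := (F.image fun R => R.2.1).bddBelow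
    exact ⟨b - 1, fun R hR => by
      have : b ≤ R.2.1 := hb (Finset.mem_coe.2 (Finset.mem_image_of_mem _ hR))
      omega⟩
  have hmain := tsum_biHalfDiff_le D₁ D₂ (isBiMartingale_rectAvg hfi)
    (isBiMartingale_rectAvg h.integrableOn_right) (isBiMartingale_rectAvg h.integrableOn_left)
    h.symm.rectAvg_pos h.rectAvg_pos h.symm.one_le_avg_mul_avg h.symm.avg_mul_avg_le k₀ l₀
  -- On the smallest rectangles the square function bound is Cauchy–Schwarz.
  have hbottom : ∀ R, rectArea R * (rectAvg D₁ D₂ f R ^ 2 / rectAvg D₁ D₂ σ R) ≤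
      ∫ x in dyadicRect D₁ D₂ R, f x ^ 2 * w x := by
    intro R
    have h1 := sq_integral_le (μ := volume.restrict (dyadicRect D₁ D₂ R)) (f := f)
      hf.restrict (ae_restrict_of_ae h.pos) (ae_restrict_of_ae h.inv)
      hfw.integrableOn (h.integrableOn_right R)
    have h2 := rectArea_pos R
    have h3 := h.symm.rectAvg_pos R
    rw [← mul_div_assoc, div_le_iff₀ h3]
    unfold rectAvg
    field_simp
    exact h1
  have hdisj : Pairwise (Function.onFun Disjoint fun p : ℤ × ℤ =>
      dyadicRect D₁ D₂ ((k₀, p.1), (l₀, p.2))) := by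
    rintro ⟨a, b⟩ ⟨c, d⟩ hne
    by_cases hac : a = c
    · have hbd : b ≠ d := fun hbd => hne (by rw [hac, hbd])
      exact Disjoint.set_prod_right (D₂.disjoint_generation l₀ hbd) _ _
    · exact Disjoint.set_prod_left (D₁.disjoint_generation k₀ hac) _ _
  have hsum : ∑' p : ℤ × ℤ, ENNReal.ofReal (length (k₀, p.1) * length (l₀, p.2) *
      (rectAvg D₁ D₂ f ((k₀, p.1), (l₀, p.2)) ^ 2 / rectAvg D₁ D₂ σ ((k₀, p.1), (l₀, p.2)))) ≤
      ENNReal.ofReal (∫ x, f x ^ 2 * w x) := by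
    rw [ofReal_integral_eq_lintegral_ofReal hfw hnn]
    refine le_trans ?_ (setLIntegral_le_lintegral
      (⋃ p : ℤ × ℤ, dyadicRect D₁ D₂ ((k₀, p.1), (l₀, p.2))) _)
    rw [lintegral_iUnion (fun p => measurableSet_dyadicRect _ _ _) hdisj]
    refine ENNReal.tsum_le_tsum fun p => ?_
    rw [← ofReal_integral_eq_lintegral_ofReal hfw.integrableOn (ae_restrict_of_ae hnn)]
    exact ENNReal.ofReal_le_ofReal (hbottom ((k₀, p.1), (l₀, p.2)))
  have hint : 0 ≤ ∫ x, f x ^ 2 * w x := integral_nonneg_of_ae hnn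
  rw [← ENNReal.ofReal_le_ofReal_iff (by positivity),
    ENNReal.ofReal_sum_of_nonneg fun R _ => div_nonneg (sq_nonneg _) (h.symm.rectAvg_pos R).le]
  calc
    _ = ∑ R ∈ F, (if k₀ < R.1.1 ∧ l₀ < R.2.1 then ENNReal.ofReal (length R.1 * length R.2 *
          (biHalfDiff D₁ D₂ (rectAvg D₁ D₂ f) R ^ 2 / rectAvg D₁ D₂ σ R)) else 0) := by
      refine Finset.sum_congr rfl fun R hR => ?_
      rw [if_pos ⟨hk₀ R hR, hl₀ R hR⟩, haarCoeff_sq hfi, mul_div_assoc, rectArea]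
    _ ≤ _ := ENNReal.sum_le_tsum F
    _ ≤ _ := hmain
    _ ≤ ENNReal.ofReal (50 * A ^ 2) ^ 2 * ENNReal.ofReal (∫ x, f x ^ 2 * w x) := by gcongr
    _ = _ := by
      rw [← ENNReal.ofReal_pow (by positivity), ← ENNReal.ofReal_mul (by positivity)]
      congr 1
      ring

variable {𝕜 : Type*} [RCLike 𝕜] {f : ℝ × ℝ → 𝕜}

theorem integrableOn_rect (h : IsDyadicA2Pair D₁ D₂ w σ A)
    (hf : AEStronglyMeasurable f) (hfw : Integrable fun x => ‖f x‖ ^ 2 * w x) (R : RectIndex) :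
    IntegrableOn f (dyadicRect D₁ D₂ R) :=
  integrable_of_integrable_sq_mul hf.restrict (ae_restrict_of_ae h.pos)
    (ae_restrict_of_ae h.inv) hfw.integrableOn (h.integrableOn_right R)

/-- The bi-parameter square function estimate. -/
theorem sum_haarCoeff_sq (h : IsDyadicA2Pair D₁ D₂ w σ A)
    (hf : AEStronglyMeasurable f) (hfw : Integrable fun x => ‖f x‖ ^ 2 * w x)
    (F : Finset RectIndex) :
    ∑ R ∈ F, ‖haarCoeff D₁ D₂ f R‖ ^ 2 / rectAvg D₁ D₂ σ R ≤
      2500 * A ^ 4 * ∫ x, ‖f x‖ ^ 2 * w x := by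
  have hfi := h.integrableOn_rect hf hfw
  have hre : AEStronglyMeasurable fun x => RCLike.re (f x) :=
    RCLike.continuous_re.comp_aestronglyMeasurable hf
  have him : AEStronglyMeasurable fun x => RCLike.im (f x) :=
    RCLike.continuous_im.comp_aestronglyMeasurable hf
  have hrew : Integrable fun x => RCLike.re (f x) ^ 2 * w x := by
    refine hfw.mono ((hre.pow 2).mul h.aestronglyMeasurable) ?_
    filter_upwards with x
    simp only [norm_mul, norm_pow, norm_norm]
    gcongr
    exact RCLike.abs_re_le_norm (f x)
  have himw : Integrable fun x => RCLike.im (f x) ^ 2 * w x := by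
    refine hfw.mono ((him.pow 2).mul h.aestronglyMeasurable) ?_
    filter_upwards with x
    simp only [norm_mul, norm_pow, norm_norm]
    gcongr
    exact RCLike.abs_im_le_norm (f x)
  have e : ∫ x, ‖f x‖ ^ 2 * w x =
      (∫ x, RCLike.re (f x) ^ 2 * w x) + ∫ x, RCLike.im (f x) ^ 2 * w x := by
    rw [← integral_add hrew himw]
    congr 1 with x
    rw [RCLike.norm_sq_eq_def]
    ring
  have h1 := h.sum_haarCoeff_sq_real hre hrew F
  have h2 := h.sum_haarCoeff_sq_real him himw F
  rw [e, mul_add]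
  refine le_trans (le_of_eq ?_) (add_le_add h1 h2)
  rw [← Finset.sum_add_distrib]
  refine Finset.sum_congr rfl fun R _ => ?_
  rw [haarCoeff_re hfi, haarCoeff_im hfi, RCLike.norm_sq_eq_def]
  ring

end IsDyadicA2Pair

/-! ### Bi-parameter weights on dyadic rectangles -/

theorem volume_dyadicRect (D₁ D₂ : DyadicGrid) (R : RectIndex) :
    volume (dyadicRect D₁ D₂ R) = ENNReal.ofReal (rectArea R) := by
  rw [dyadicRect, Measure.volume_eq_prod, Measure.prod_prod, rectArea,
    ENNReal.ofReal_mul (length_pos _).le]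
  simp only [interval, Real.volume_Ico, add_sub_cancel_left]

namespace IsBiA2Weight

variable {w : ℝ × ℝ → ℝ}

/-- The `A₂` condition over the half-open dyadic rectangles, which differ from closed ones by null
sets. -/
theorem setLIntegral_mul_le (w : ℝ × ℝ → ℝ) (D₁ D₂ : DyadicGrid) (R : RectIndex) :
    ((∫⁻ x in dyadicRect D₁ D₂ R, ENNReal.ofReal (w x)) / volume (dyadicRect D₁ D₂ R)) *
      ((∫⁻ x in dyadicRect D₁ D₂ R, ENNReal.ofReal (w x)⁻¹) / volume (dyadicRect D₁ D₂ R)) ≤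
      biA2Char w := by
  have hl₁ := length_pos R.1
  have hl₂ := length_pos R.2
  have hae : dyadicRect D₁ D₂ R =ᵐ[volume]
      Icc (D₁.left R.1) (D₁.left R.1 + length R.1) ×ˢ
        Icc (D₂.left R.2) (D₂.left R.2 + length R.2) :=
    Measure.set_prod_ae_eq Ico_ae_eq_Icc Ico_ae_eq_Icc
  rw [setLIntegral_congr hae, setLIntegral_congr hae, measure_congr hae, ← setLAverage_eq,
    ← setLAverage_eq]
  unfold biA2Char
  exact le_iSup_of_le (D₁.left R.1) <| le_iSup_of_le (D₁.left R.1 + length R.1) <|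
    le_iSup_of_le (D₂.left R.2) <| le_iSup_of_le (D₂.left R.2 + length R.2) <|
    le_iSup_of_le (by linarith) <| le_iSup_of_le (by linarith) le_rfl

theorem integrableOn_rect (hw : IsBiA2Weight w) (D₁ D₂ : DyadicGrid) (R : RectIndex) :
    IntegrableOn w (dyadicRect D₁ D₂ R) :=
  (hw.locallyIntegrable.integrableOn_isCompact (isCompact_Icc.prod isCompact_Icc)).mono_set
    (prod_mono Ico_subset_Icc_self Ico_subset_Icc_self)

/-- Local integrability of `w⁻¹` is not assumed of a weight: it follows from `[w]_{A₂} < ∞`, as the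
averages of `w` do not vanish. -/
theorem setLIntegral_inv_ne_top (hw : IsBiA2Weight w) (D₁ D₂ : DyadicGrid) (R : RectIndex) :
    ∫⁻ x in dyadicRect D₁ D₂ R, ENNReal.ofReal (w x)⁻¹ ≠ ∞ := by
  intro htop
  have hvol := volume_dyadicRect D₁ D₂ R
  have hpos := rectArea_pos R
  have hW : ∫⁻ x in dyadicRect D₁ D₂ R, ENNReal.ofReal (w x) ≠ 0 := by
    intro h0
    rw [lintegral_eq_zero_iff' (hw.integrableOn_rect D₁ D₂ R).aemeasurable.ennreal_ofReal] at h0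
    have : ∀ᵐ x ∂volume.restrict (dyadicRect D₁ D₂ R), False := by
      filter_upwards [h0, ae_restrict_of_ae hw.pos] with x h1 h2
      simp only [Pi.zero_apply, ENNReal.ofReal_eq_zero] at h1
      linarith
    rw [Filter.eventually_false_iff_eq_bot, ae_eq_bot, Measure.restrict_eq_zero, hvol] at this
    simp only [ENNReal.ofReal_eq_zero] at this
    linarith
  have h := setLIntegral_mul_le w D₁ D₂ R
  rw [htop, hvol, ENNReal.top_div_of_ne_top ENNReal.ofReal_ne_top, ENNReal.mul_top
    (ENNReal.div_pos hW ENNReal.ofReal_ne_top).ne'] at h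
  exact hw.char_lt_top.not_ge h

theorem isDyadicA2Pair (hw : IsBiA2Weight w) (D₁ D₂ : DyadicGrid) :
    IsDyadicA2Pair D₁ D₂ w (fun x => (w x)⁻¹) (biA2Char w).toReal where
  aestronglyMeasurable := hw.locallyIntegrable.aestronglyMeasurable
  pos := hw.pos
  inv := ae_of_all _ fun _ => rfl
  integrableOn_left := hw.integrableOn_rect D₁ D₂
  integrableOn_right R := by
    refine ⟨hw.locallyIntegrable.aestronglyMeasurable.inv₀.restrict, ?_⟩
    rw [hasFiniteIntegral_iff_ofReal]
    · exact (hw.setLIntegral_inv_ne_top D₁ D₂ R).lt_top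
    · filter_upwards [ae_restrict_of_ae hw.pos] with x hx
      exact (inv_pos.2 hx).le
  avg_mul_avg_le R := by
    have h := ENNReal.toReal_mono hw.char_lt_top.ne (setLIntegral_mul_le w D₁ D₂ R)
    rw [ENNReal.toReal_mul, ENNReal.toReal_div, ENNReal.toReal_div, volume_dyadicRect,
      ENNReal.toReal_ofReal (rectArea_pos R).le] at h
    unfold rectAvg
    rwa [integral_eq_lintegral_of_nonneg_ae
        (ae_restrict_of_ae (hw.pos.mono fun x hx => hx.le))
        hw.locallyIntegrable.aestronglyMeasurable.restrict,
      integral_eq_lintegral_of_nonneg_ae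
        (ae_restrict_of_ae (hw.pos.mono fun x hx => (inv_pos.2 hx).le))
        hw.locallyIntegrable.aestronglyMeasurable.inv₀.restrict]

end IsBiA2Weight

/-! ### The space `L²(w)` -/

section WeightedL2

variable {E : Type*} [NormedAddCommGroup E] {w : ℝ × ℝ → ℝ} {f : ℝ × ℝ → E}

theorem integral_norm_sq_weightMeasure (hw : AEStronglyMeasurable w) (hpos : ∀ᵐ x, 0 < w x) :
    ∫ x, ‖f x‖ ^ 2 ∂weightMeasure w = ∫ x, ‖f x‖ ^ 2 * w x := by
  rw [weightMeasure, integral_withDensity_eq_integral_toReal_smul₀ hw.aemeasurable.ennreal_ofReal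
    (ae_of_all _ fun _ => ENNReal.ofReal_lt_top)]
  apply integral_congr_ae
  filter_upwards [hpos] with x hx
  rw [ENNReal.toReal_ofReal hx.le, smul_eq_mul, mul_comm]

theorem memLp_weightMeasure_iff (hw : AEStronglyMeasurable w) (hpos : ∀ᵐ x, 0 < w x)
    (hf : AEStronglyMeasurable f) :
    MemLp f 2 (weightMeasure w) ↔ Integrable fun x => ‖f x‖ ^ 2 * w x := by
  rw [weightMeasure,
    memLp_two_iff_integrable_sq_norm (hf.mono_ac (withDensity_absolutelyContinuous _ _)),
    integrable_withDensity_iff_integrable_smul₀' hw.aemeasurable.ennreal_ofReal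
    (ae_of_all _ fun _ => ENNReal.ofReal_lt_top)]
  apply integrable_congr
  filter_upwards [hpos] with x hx
  rw [ENNReal.toReal_ofReal hx.le, smul_eq_mul, mul_comm]

theorem aestronglyMeasurable_of_weightMeasure (hw : AEStronglyMeasurable w)
    (hpos : ∀ᵐ x, 0 < w x) (hf : AEStronglyMeasurable f (weightMeasure w)) :
    AEStronglyMeasurable f :=
  hf.mono_ac <| withDensity_absolutelyContinuous' hw.aemeasurable.ennreal_ofReal <| by
    filter_upwards [hpos] with x hx
    simpa using hx

theorem eLpNorm_weightMeasure (hw : AEStronglyMeasurable w) (hpos : ∀ᵐ x, 0 < w x)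
    (hf : MemLp f 2 (weightMeasure w)) :
    eLpNorm f 2 (weightMeasure w) = ENNReal.ofReal √(∫ x, ‖f x‖ ^ 2 * w x) := by
  rw [hf.eLpNorm_eq_integral_rpow_norm two_ne_zero ENNReal.ofNat_ne_top, Real.sqrt_eq_rpow,
    ← integral_norm_sq_weightMeasure hw hpos]
  norm_num

end WeightedL2

/-! ### Norms of finite Haar sums -/

theorem haar_sq (D : DyadicGrid) (I : DyadicIndex) (t : ℝ) :
    D.haar I t ^ 2 = (D.interval I).indicator (fun _ => (length I)⁻¹) t := by
  have hl := length_pos I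
  have hd := D.disjoint_lower_upper I
  rw [D.interval_eq_union I, haar, mul_pow, inv_pow, Real.sq_sqrt hl.le, ← interval_lower,
    ← interval_upper]
  by_cases h1 : t ∈ D.interval (D.lower I)
  · have h2 := disjoint_left.1 hd h1
    simp [h1, h2]
  · by_cases h2 : t ∈ D.interval (D.upper I) <;> simp [h1, h2]

namespace IsDyadicA2Pair

variable {D₁ D₂ : DyadicGrid} {w σ : ℝ × ℝ → ℝ} {A : ℝ} {𝕜 : Type*} [RCLike 𝕜]

theorem memLp_biHaar (h : IsDyadicA2Pair D₁ D₂ w σ A) (c : 𝕜) (R : RectIndex) :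
    MemLp (fun x => c * (biHaar D₁ D₂ R x : 𝕜)) 2 (weightMeasure w) := by
  refine MemLp.const_mul ?_ c
  have hm : AEStronglyMeasurable fun x => (biHaar D₁ D₂ R x : 𝕜) :=
    RCLike.continuous_ofReal.comp_aestronglyMeasurable
      (measurable_biHaar D₁ D₂ R).aestronglyMeasurable
  rw [memLp_weightMeasure_iff h.aestronglyMeasurable h.pos hm]
  refine (((h.integrableOn_left R).integrable_indicator
    (measurableSet_dyadicRect D₁ D₂ R)).const_mul (rectArea R)⁻¹).congr ?_
  filter_upwards with x
  rw [RCLike.norm_ofReal, sq_abs, biHaar, mul_pow, haar_sq, haar_sq, rectArea, dyadicRect]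
  by_cases h1 : x.1 ∈ D₁.interval R.1 <;> by_cases h2 : x.2 ∈ D₂.interval R.2 <;>
    simp [indicator, h1, h2, mul_comm]

/-- The reverse square function estimate, by duality: `P = ∑ c_R h_R` is tested against
`g = P̄ w`, whose norm in `L²(w⁻¹)` is that of `P` in `L²(w)`, and the square function estimate for
the weight `w⁻¹` is applied to `g`. -/
theorem integral_norm_sq_sum_le (h : IsDyadicA2Pair D₁ D₂ w σ A) (c : RectIndex → 𝕜)
    (F : Finset RectIndex) :
    ∫ x, ‖∑ R ∈ F, c R * (biHaar D₁ D₂ R x : 𝕜)‖ ^ 2 * w x ≤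
      2500 * A ^ 4 * ∑ R ∈ F, ‖c R‖ ^ 2 * rectAvg D₁ D₂ w R := by
  obtain ⟨P, hP⟩ : ∃ P : ℝ × ℝ → 𝕜, P = fun x => ∑ R ∈ F, c R * (biHaar D₁ D₂ R x : 𝕜) :=
    ⟨_, rfl⟩
  have hPL : MemLp P 2 (weightMeasure w) := by
    rw [hP]
    exact memLp_finsetSum F fun R _ => h.memLp_biHaar (c R) R
  have hPm := aestronglyMeasurable_of_weightMeasure h.aestronglyMeasurable h.pos hPL.1
  have hPi := (memLp_weightMeasure_iff h.aestronglyMeasurable h.pos hPm).1 hPL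
  change ∫ x, ‖(fun x => ∑ R ∈ F, c R * (biHaar D₁ D₂ R x : 𝕜)) x‖ ^ 2 * w x ≤ _
  rw [← hP]
  obtain ⟨g, hg⟩ : ∃ g : ℝ × ℝ → 𝕜, g = fun x => starRingEnd 𝕜 (P x) * (w x : 𝕜) := ⟨_, rfl⟩
  have hgm : AEStronglyMeasurable g := by
    rw [hg]
    exact (RCLike.continuous_conj.comp_aestronglyMeasurable hPm).mul
      (RCLike.continuous_ofReal.comp_aestronglyMeasurable h.aestronglyMeasurable)
  have hgP : (fun x => ‖P x‖ ^ 2 * w x) =ᵐ[volume] fun x => ‖g x‖ ^ 2 * σ x := by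
    filter_upwards [h.pos, h.inv] with x hx hx'
    rw [hg, hx']
    simp only [norm_mul, RCLike.norm_conj, RCLike.norm_ofReal, mul_pow, sq_abs]
    field_simp
  have hgi : Integrable fun x => ‖g x‖ ^ 2 * σ x := hPi.congr hgP
  have hsq := h.symm.sum_haarCoeff_sq hgm hgi F
  rw [← integral_congr_ae hgP] at hsq
  have hpair : ((∫ x, ‖P x‖ ^ 2 * w x : ℝ) : 𝕜) = ∑ R ∈ F, c R * haarCoeff D₁ D₂ g R := by
    simp only [haarCoeff, ← integral_const_mul]
    rw [← integral_finsetSum F fun R _ => (integrable_mul_biHaar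
      (h.symm.integrableOn_rect hgm hgi) R).const_mul (c R), ← integral_ofReal]
    congr 1 with x
    have : ∑ R ∈ F, c R * (g x * (biHaar D₁ D₂ R x : 𝕜)) = g x * P x := by
      rw [hP, Finset.mul_sum]
      exact Finset.sum_congr rfl fun R _ => by ring
    rw [this, hg]
    push_cast
    rw [← RCLike.conj_mul]
    ring
  have hQ0 : 0 ≤ ∫ x, ‖P x‖ ^ 2 * w x := by
    apply integral_nonneg_of_ae
    filter_upwards [h.pos] with x hx
    simp only [Pi.zero_apply]
    positivity
  generalize ∫ x, ‖P x‖ ^ 2 * w x = Q at *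
  have hle : Q ≤ ∑ R ∈ F, (‖c R‖ * √(rectAvg D₁ D₂ w R)) *
      (‖haarCoeff D₁ D₂ g R‖ / √(rectAvg D₁ D₂ w R)) := by
    have h1 : Q = ‖(Q : 𝕜)‖ := by rw [RCLike.norm_ofReal, abs_of_nonneg hQ0]
    rw [h1, hpair]
    refine (norm_sum_le _ _).trans (Finset.sum_le_sum fun R _ => ?_)
    have := Real.sqrt_pos.2 (h.rectAvg_pos R)
    rw [norm_mul]
    field_simp
    exact le_rfl
  have hcs := Finset.sum_mul_sq_le_sq_mul_sq F (fun R => ‖c R‖ * √(rectAvg D₁ D₂ w R))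
    (fun R => ‖haarCoeff D₁ D₂ g R‖ / √(rectAvg D₁ D₂ w R))
  simp only [mul_pow, div_pow, Real.sq_sqrt (h.rectAvg_pos _).le] at hcs
  have hS0 : 0 ≤ ∑ R ∈ F, ‖c R‖ ^ 2 * rectAvg D₁ D₂ w R :=
    Finset.sum_nonneg fun R _ => mul_nonneg (sq_nonneg _) (h.rectAvg_pos R).le
  have hQ2 : Q ^ 2 ≤ (∑ R ∈ F, ‖c R‖ ^ 2 * rectAvg D₁ D₂ w R) * (2500 * A ^ 4 * Q) :=
    (pow_le_pow_left₀ hQ0 hle 2).trans (hcs.trans (by gcongr))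
  rcases hQ0.eq_or_lt with h0 | h0
  · rw [← h0]
    positivity
  · nlinarith

theorem sum_martingaleTransform_le (h : IsDyadicA2Pair D₁ D₂ w σ A) {ε : RectIndex → 𝕜}
    {B : ℝ} (hε : ∀ R, ‖ε R‖ ≤ B) {f : ℝ × ℝ → 𝕜} (hf : AEStronglyMeasurable f)
    (hfw : Integrable fun x => ‖f x‖ ^ 2 * w x) (F : Finset RectIndex) :
    ∑ R ∈ F, ‖ε R * haarCoeff D₁ D₂ f R‖ ^ 2 * rectAvg D₁ D₂ w R ≤
      B ^ 2 * A * (2500 * A ^ 4 * ∫ x, ‖f x‖ ^ 2 * w x) := by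
  have hA1 := (h.one_le_avg_mul_avg ((0, 0), (0, 0))).trans (h.avg_mul_avg_le _)
  refine le_trans ?_ (mul_le_mul_of_nonneg_left (h.sum_haarCoeff_sq hf hfw F) (by positivity))
  rw [Finset.mul_sum]
  refine Finset.sum_le_sum fun R _ => ?_
  have hσ := h.symm.rectAvg_pos R
  have hv : rectAvg D₁ D₂ w R ≤ A / rectAvg D₁ D₂ σ R := by
    rw [le_div_iff₀ hσ]
    exact h.avg_mul_avg_le R
  have hw := h.rectAvg_pos R
  calc
    _ = ‖ε R‖ ^ 2 * ‖haarCoeff D₁ D₂ f R‖ ^ 2 * rectAvg D₁ D₂ w R := by rw [norm_mul, mul_pow]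
    _ ≤ B ^ 2 * ‖haarCoeff D₁ D₂ f R‖ ^ 2 * (A / rectAvg D₁ D₂ σ R) := by
      gcongr
      exact hε R
    _ = _ := by ring

end IsDyadicA2Pair

/-! ### Convergence of the martingale transform -/

theorem theorem3 {𝕜 : Type*} [RCLike 𝕜] :
    ∃ C : ℝ≥0, ∀ (D₁ D₂ : DyadicGrid) (ε : RectIndex → 𝕜) (Cε : ℝ≥0),
      (∀ R : RectIndex, ‖ε R‖ ≤ (Cε : ℝ)) →
      ∀ w : ℝ × ℝ → ℝ, IsBiA2Weight w →
      ∀ f : ℝ × ℝ → 𝕜, MemLp f 2 (weightMeasure w) →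
        ∃ Tf : ℝ × ℝ → 𝕜, IsMartingaleTransform D₁ D₂ ε w f Tf ∧
          eLpNorm Tf 2 (weightMeasure w) ≤
            (C : ℝ≥0∞) * (Cε : ℝ≥0∞) * biA2Char w ^ 8 * eLpNorm f 2 (weightMeasure w) := by
  refine ⟨2500, fun D₁ D₂ ε Cε hε w hw f hf => ?_⟩
  have h := hw.isDyadicA2Pair D₁ D₂
  have hA1 := (h.one_le_avg_mul_avg ((0, 0), (0, 0))).trans (h.avg_mul_avg_le _)
  have hfm := aestronglyMeasurable_of_weightMeasure h.aestronglyMeasurable h.pos hf.1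
  have hfw := (memLp_weightMeasure_iff h.aestronglyMeasurable h.pos hfm).1 hf
  obtain ⟨A, hA⟩ : ∃ A, A = (biA2Char w).toReal := ⟨_, rfl⟩
  have hAchar : biA2Char w = ENNReal.ofReal A := by
    rw [hA, ENNReal.ofReal_toReal hw.char_lt_top.ne]
  rw [← hA] at h hA1
  obtain ⟨N, hN⟩ : ∃ N, N = ∫ x, ‖f x‖ ^ 2 * w x := ⟨_, rfl⟩
  have hN0 : 0 ≤ N := by
    rw [hN]
    apply integral_nonneg_of_ae
    filter_upwards [h.pos] with x hx
    simp only [Pi.zero_apply]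
    positivity
  obtain ⟨c, hc⟩ : ∃ c : RectIndex → 𝕜, c = fun R => ε R * haarCoeff D₁ D₂ f R := ⟨_, rfl⟩
  have hsum : ∀ F : Finset RectIndex, ∑ R ∈ F, ‖c R‖ ^ 2 * rectAvg D₁ D₂ w R ≤
      (Cε : ℝ) ^ 2 * A * (2500 * A ^ 4 * N) := fun F => by
    rw [hc, hN]
    exact h.sum_martingaleTransform_le hε hfm hfw F
  have hsummable : Summable fun R => ‖c R‖ ^ 2 * rectAvg D₁ D₂ w R :=
    summable_of_sum_le (fun R => mul_nonneg (sq_nonneg _) (h.rectAvg_pos R).le) hsum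
  let u : RectIndex → Lp 𝕜 2 (weightMeasure w) := fun R => (h.memLp_biHaar (c R) R).toLp
  have hmem : ∀ F : Finset RectIndex,
      MemLp (fun x => ∑ R ∈ F, c R * (biHaar D₁ D₂ R x : 𝕜)) 2 (weightMeasure w) :=
    fun F => memLp_finsetSum F fun R _ => h.memLp_biHaar (c R) R
  have hu : ∀ F : Finset RectIndex, ∑ R ∈ F, u R = (hmem F).toLp := by
    intro F
    induction F using Finset.cons_induction with
    | empty =>
      simp only [Finset.sum_empty]
      exact (MemLp.toLp_zero _).symm
    | cons R F hR ih =>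
      rw [Finset.sum_cons, ih, ← MemLp.toLp_add]
      congr 1
      funext x
      exact (Finset.sum_cons (f := fun R => c R * (biHaar D₁ D₂ R x : 𝕜)) hR).symm
  have hnorm : ∀ F : Finset RectIndex, ‖∑ R ∈ F, u R‖ ≤
      √(2500 * A ^ 4 * ∑ R ∈ F, ‖c R‖ ^ 2 * rectAvg D₁ D₂ w R) := by
    intro F
    rw [hu, Lp.norm_toLp, eLpNorm_weightMeasure h.aestronglyMeasurable h.pos (hmem F),
      ENNReal.toReal_ofReal (Real.sqrt_nonneg _)]
    exact Real.sqrt_le_sqrt (h.integral_norm_sq_sum_le c F)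
  have hus : Summable u := by
    rw [summable_iff_vanishing_norm]
    intro δ hδ
    obtain ⟨s, hs⟩ := summable_iff_vanishing_norm.1 hsummable (δ ^ 2 / (2500 * A ^ 4))
      (by positivity)
    refine ⟨s, fun t ht => (hnorm t).trans_lt ?_⟩
    rw [Real.sqrt_lt' hδ, ← lt_div_iff₀' (by positivity)]
    exact (Real.le_norm_self _).trans_lt (hs t ht)
  refine ⟨(∑' R, u R : Lp 𝕜 2 (weightMeasure w)), ⟨?_, Lp.memLp _, ?_⟩, ?_⟩
  · exact integrable_mul_biHaar (h.integrableOn_rect hfm hfw)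
  · have hlim : Tendsto (fun F : Finset RectIndex => ‖(∑' R, u R) - ∑ R ∈ F, u R‖)
        atTop (𝓝 0) := by
      have := (hus.hasSum.const_sub (∑' R, u R)).norm
      simpa using this
    have hlim' := ENNReal.tendsto_ofReal hlim
    rw [ENNReal.ofReal_zero] at hlim'
    refine hlim'.congr fun F => ?_
    rw [ofReal_norm, Lp.enorm_def]
    apply eLpNorm_congr_ae
    have h1 := Lp.coeFn_sub (∑' R, u R) (∑ R ∈ F, u R)
    have h2 : ⇑(∑ R ∈ F, u R) =ᵐ[weightMeasure w]
        fun x => ∑ R ∈ F, c R * (biHaar D₁ D₂ R x : 𝕜) := by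
      rw [hu]
      exact (hmem F).coeFn_toLp
    filter_upwards [h1, h2] with x hx1 hx2
    rw [hx1, Pi.sub_apply, hx2, hc]
  · have hbound : ‖∑' R, u R‖ ≤ 2500 * Cε * A ^ 8 * √N := by
      refine le_of_tendsto hus.hasSum.norm (Eventually.of_forall fun F => (hnorm F).trans ?_)
      rw [Real.sqrt_le_left (by positivity), mul_pow, Real.sq_sqrt hN0]
      -- The argument gives the exponent `9 / 2`, and `1 ≤ A`.
      have h9 : A ^ 9 ≤ A ^ 16 := pow_le_pow_right₀ hA1 (by norm_num)
      calc
        _ ≤ 2500 * A ^ 4 * ((Cε : ℝ) ^ 2 * A * (2500 * A ^ 4 * N)) := by gcongr; exact hsum F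
        _ = (2500 * Cε) ^ 2 * A ^ 9 * N := by ring
        _ ≤ (2500 * Cε) ^ 2 * A ^ 16 * N := by gcongr
        _ = _ := by ring
    rw [← Lp.enorm_def, ← ofReal_norm, eLpNorm_weightMeasure h.aestronglyMeasurable h.pos hf,
      ← hN, hAchar]
    refine (ENNReal.ofReal_le_ofReal hbound).trans (le_of_eq ?_)
    rw [ENNReal.ofReal_mul (by positivity), ENNReal.ofReal_mul (by positivity),
      ENNReal.ofReal_mul (by positivity), ENNReal.ofReal_pow (by positivity),
      ENNReal.ofReal_coe_nnreal]
    simp
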